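/- Let $d\ge 1$. For a set $S\subset\mathbb R$ with finitely many points in every bounded interval, let $C_p^0(\mathbb R)$ be the class of functions on $\mathbb R$ that have only finitely many discontinuities in every bounded interval and are absolutely integrable on bounded intervals, and let $C^{2}_{p}(\mathbb R;S)$ be the class of continuously differentiable functions $f:\mathbb R\to\mathbb C$ such that $f'$ is differentiable off $S$ and $f''\in C_p^0(\mathbb R)$ (values of $f''$ on $S$ being immaterial). Fix sets $E_1,\dots,E_d\subset\mathbb R$ that are invariant under translation by $1$ and have finitely many points in every bounded interval; $E_j=\emptyset$ for all $j$ is allowed. Let $V:\mathbb R^d\to\mathbb R$ be $\mathbb Z^d$-periodic and in $C_p^0(\mathbb R)$ along every line parallel to a coordinate axis, and let $\lambda\in\mathbb R$. A *solution* of $$-\tfrac12\Delta\Psi+V\Psi=\lambda\Psi \qquad (*)$$ is a function $\Psi:\mathbb R^d\to\mathbb C$ which, along every line parallel to the $j$-th axis, is in $C^2_p(\mathbb R;E_j)$ as a function of $x_j$ ($j=1,\dots,d$), and which satisfies $(*)$, with $\Delta$ the sum of the pure second partial derivatives, at every $x$ with $x_j\notin E_j$ for all $j$. (If all $E_j$ are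 empty, these are the classical solutions, satisfying $(*)$ everywhere.) A solution $\Phi\not\equiv0$ is a *Bloch solution with quasimomentum* $k\in\mathbb R^d$ if $\Phi(x+a)=e^{ik\cdot a}\Phi(x)$ for all $x\in\mathbb R^d$, $a\in\mathbb Z^d$. Let $\Psi\not\equiv 0$ be a bounded solution of $(*)$ that is separable, i.e. $\Psi(x)=\prod_{j=1}^d\psi_j(x_j)$ for some functions $\psi_j:\mathbb R\to\mathbb C$. Then there are $s\in\{1,\dots,d\}$, Bloch solutions $\Phi_1,\dots,\Phi_{2^s}$ of $(*)$ with the same $\lambda$ and with quasimomenta $k^{(1)},\dots,k^{(2^s)}\in[-\pi,\pi]^d$, and $c_1,\dots,c_{2^s}\in\mathbb C$ (some of which may be $0$) such that $$\Psi=\sum_{i=1}^{2^s}c_i\Phi_i ,$$ and the quasimomenta are distributed symmetrically about the coordinate axes: for each $j\in\{1,\dots,d\}$ the reflection $k_j\mapsto -k_j$ of the $j$-th coordinate permutes the family $k^{(1)},\dots,k^{(2^s)}$ modulo $2\pi\mathbb Z^d$. Moreover, the $2^s$ quasimomenta are pairwise incongruent modulo $2\pi\mathbb Z^d$, except possibly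 when $s=1$ and all their components are integer multiples of $\pi$. -/

import Mathlib

open scoped BigOperators

namespace PeriodicSchrodinger

/-- A set of reals with only finitely many points in every bounded interval. -/
def FiniteOnIntervals (S : Set ℝ) : Prop :=
  ∀ a b : ℝ, (S ∩ Set.Icc a b).Finite

/-- Only finitely many discontinuity points on any finite interval. -/
def PiecewiseContinuous {F : Type*} [NormedAddCommGroup F] (f : ℝ → F) : Prop :=
  FiniteOnIntervals {t | ¬ ContinuousAt f t}

/-- The classes `C_p^l(ℝ)`: `C_p^0` consists of the piecewise continuous functions that are
absolutely integrable on bounded intervals, and `C_p^(l+1)` of the functions that are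
differentiable with derivative in `C_p^l`.

The set `S` collects the points at which the top-order derivative is allowed not to exist
(jumps of the coefficients). For `S = ∅` all derivatives exist everywhere. If `S` has only finitely
many points in bounded intervals, then a function in `Cp S 2` is continuously differentiable on
all of `ℝ`, and its derivative is differentiable off `S`. -/
def Cp {F : Type*} [NormedAddCommGroup F] [NormedSpace ℝ F] (S : Set ℝ) :
    ℕ → (ℝ → F) → Prop
  | 0, f => PiecewiseContinuous f ∧ MeasureTheory.LocallyIntegrable f MeasureTheory.volume
  | l + 1, f => Continuous f ∧ (∀ t, t ∉ S → DifferentiableAt ℝ f t) ∧ Cp S l (deriv f)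

/-- The restriction of `f` to the line through `x` in the direction of the `j`-th axis,
parametrized by the `j`-th coordinate. -/
def slice {d : ℕ} {F : Type*} (f : (Fin d → ℝ) → F) (x : Fin d → ℝ) (j : Fin d) : ℝ → F :=
  fun t => f (Function.update x j t)

/-- `f` is in `C_p^l(ℝ)` in the direction of every coordinate axis. -/
def TensorCp {d : ℕ} {F : Type*} [NormedAddCommGroup F] [NormedSpace ℝ F]
    (E : Fin d → Set ℝ) (l : ℕ) (f : (Fin d → ℝ) → F) : Prop :=
  ∀ (x : Fin d → ℝ) (j : Fin d), Cp (E j) l (slice f x j)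

/-- The Laplacian, as the sum of the pure second partial derivatives. -/
noncomputable def laplacian {d : ℕ} (f : (Fin d → ℝ) → ℂ) (x : Fin d → ℝ) : ℂ :=
  ∑ j : Fin d, deriv (deriv (slice f x j)) (x j)

/-- The translation vector of the lattice `ℤ^d` with coordinates `n`. -/
def latticeVec {d : ℕ} (n : Fin d → ℤ) : Fin d → ℝ := fun j => (n j : ℝ)

/-- `ℤ^d`-periodicity. -/
def LatticePeriodic {d : ℕ} {F : Type*} (f : (Fin d → ℝ) → F) : Prop :=
  ∀ (n : Fin d → ℤ) (x : Fin d → ℝ), f (x + latticeVec n) = f x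

/-- `Ψ` solves `-(1/2) ΔΨ + V Ψ = lam Ψ` in the classical sense, off the hyperplanes `x j = t` with
`t ∈ E j` (everywhere if all `E j` are empty). -/
def IsSolution {d : ℕ} (E : Fin d → Set ℝ) (V : (Fin d → ℝ) → ℝ) (lam : ℝ)
    (Ψ : (Fin d → ℝ) → ℂ) : Prop :=
  TensorCp E 2 Ψ ∧
    ∀ x : Fin d → ℝ, (∀ j, x j ∉ E j) →
      -(1 / 2 : ℂ) * laplacian Ψ x + (V x : ℂ) * Ψ x = (lam : ℂ) * Ψ x

/-- `Ψ` is a product of functions of one coordinate each. -/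
def IsSeparable {d : ℕ} (Ψ : (Fin d → ℝ) → ℂ) : Prop :=
  ∃ ψ : Fin d → ℝ → ℂ, ∀ x : Fin d → ℝ, Ψ x = ∏ j, ψ j (x j)

/-- `Ψ (x + a) = exp (i k·a) Ψ x` for all `a ∈ ℤ^d`: the function `Ψ` is of Bloch type with
(real) quasimomentum `k`. -/
def HasQuasimomentum {d : ℕ} (k : Fin d → ℝ) (Ψ : (Fin d → ℝ) → ℂ) : Prop :=
  ∀ (n : Fin d → ℤ) (x : Fin d → ℝ),
    Ψ (x + latticeVec n) = Complex.exp (Complex.I * ((∑ j, k j * (n j : ℝ) : ℝ) : ℂ)) * Ψ x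

/-- Congruence modulo the dual lattice `2πℤ^d`. -/
def DualCongruent {d : ℕ} (k k' : Fin d → ℝ) : Prop :=
  ∃ m : Fin d → ℤ, ∀ j, k j = k' j + 2 * Real.pi * (m j : ℝ)

/-- The reflection `k j ↦ -k j` of the `j`-th coordinate. -/
def reflect {d : ℕ} (j : Fin d) (k : Fin d → ℝ) : Fin d → ℝ :=
  Function.update k j (-k j)

/-- A finite family of quasimomenta, taken modulo `2πℤ^d`, is symmetric: reflecting any of the
coordinates only permutes the family (repetitions counted). -/
def SymmetricAboutAxes {d : ℕ} {ι : Type*} (k : ι → Fin d → ℝ) : Prop :=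
  ∀ j : Fin d, ∃ σ : Equiv.Perm ι, ∀ i, DualCongruent (k (σ i)) (reflect j (k i))

end PeriodicSchrodinger

open MeasureTheory Set Filter Topology

/-! Freezing all coordinates but the `j`-th where the other factors are nonzero shows that each
factor is a bounded solution of a Hill equation `ψ'' = q ψ` with `q` periodic and of constant
imaginary part (`exists_hill_factors`).

In one dimension let `T` be translation by 1 (`exists_bloch_pair`). If `ψ` and `Tψ` are dependent,
`ψ` is a Bloch function with multiplier of modulus one; this makes `q` real, and unless the
multiplier is `±1` the conjugate of `ψ` is a partner with opposite quasimomentum. If they are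
independent, constancy of the Wronskian gives `T` determinant 1 on their span; boundedness puts the
eigenvalues on the unit circle and excludes Jordan blocks, so `ψ` is a sum of two Bloch functions
with quasimomenta `±k`.

Multiplying out gives one Bloch product for each choice of signs in the coordinates with `k j ∉ πℤ`.
The difficulty is that `V` need not be separable: the `q j` add up to `2 (V - lam)` only where `Ψ ≠
0`. A Bloch product still solves the equation, because wherever it is nonzero some lattice translate
of the point has `Ψ ≠ 0`. -/

namespace PeriodicSchrodinger

/-! ### Locally finite exceptional sets and the classes `Cp` -/

namespace FiniteOnIntervals

theorem mono {S T : Set ℝ} (hT : FiniteOnIntervals T) (h : S ⊆ T) : FiniteOnIntervals S :=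
  fun a b => (hT a b).subset (inter_subset_inter_left _ h)

theorem union {S T : Set ℝ} (hS : FiniteOnIntervals S) (hT : FiniteOnIntervals T) :
    FiniteOnIntervals (S ∪ T) := fun a b => by
  rw [union_inter_distrib_right]
  exact (hS a b).union (hT a b)

theorem countable {S : Set ℝ} (hS : FiniteOnIntervals S) : S.Countable := by
  have h : S ⊆ ⋃ n : ℕ, S ∩ Icc (-(n : ℝ)) n := by
    intro t ht
    obtain ⟨n, hn⟩ := exists_nat_ge |t|
    exact mem_iUnion.2 ⟨n, ht, abs_le.1 hn⟩
  exact (countable_iUnion fun n : ℕ => (hS (-(n : ℝ)) n).countable).mono h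

theorem isClosed {S : Set ℝ} (hS : FiniteOnIntervals S) : IsClosed S := by
  rw [← isOpen_compl_iff, isOpen_iff_mem_nhds]
  intro t ht
  have h1 : Icc (t - 1) (t + 1) ∈ 𝓝 t := Icc_mem_nhds (by linarith) (by linarith)
  have h2 : (S ∩ Icc (t - 1) (t + 1))ᶜ ∈ 𝓝 t :=
    (hS _ _).isClosed.isOpen_compl.mem_nhds fun h => ht h.1
  filter_upwards [h1, h2] with u hu hu' hS
  exact hu' ⟨hS, hu⟩

end FiniteOnIntervals

/-- The fundamental theorem of calculus tolerates a countable exceptional set, so `f` is a primitive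
of the continuous function `deriv f`. Thus `Cp S 2` functions are `C¹` across `S` too. -/
theorem differentiable_of_continuous_deriv {S : Set ℝ} (hS : S.Countable) {f : ℝ → ℂ}
    (hf : Continuous f) (hd : ∀ t, t ∉ S → DifferentiableAt ℝ f t)
    (hf' : Continuous (deriv f)) : Differentiable ℝ f := by
  have h : f = fun t => f 0 + ∫ s in (0 : ℝ)..t, deriv f s := by
    funext t
    rw [integral_eq_of_hasDerivAt_off_countable f (deriv f) hS hf.continuousOn
      (fun x hx => (hd x hx.2).hasDerivAt) (hf'.intervalIntegrable _ _)]
    ring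
  rw [h]
  intro t
  exact ((hf'.integral_hasStrictDerivAt 0 t).hasDerivAt.differentiableAt).const_add _

theorem Cp.congr_zero {S : Set ℝ} (hS : FiniteOnIntervals S) {f g : ℝ → ℂ} (hf : Cp S 0 f)
    (h : ∀ t, t ∉ S → f t = g t) : Cp S 0 g := by
  refine ⟨(hf.1.union hS).mono ?_, hf.2.congr ?_⟩
  · intro t ht
    by_contra hn
    simp only [mem_union, not_or, mem_ofPred_eq, not_not] at hn
    refine ht (hn.1.congr ?_)
    filter_upwards [hS.isClosed.isOpen_compl.mem_nhds hn.2] with u hu using h u hu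
  · filter_upwards [hS.countable.ae_notMem volume] with t ht using h t ht

theorem Cp.mul_continuous {S : Set ℝ} {q f : ℝ → ℂ} (hq : Cp S 0 q) (hf : Continuous f) :
    Cp S 0 (fun t => q t * f t) := by
  refine ⟨hq.1.mono ?_, ?_⟩
  · intro t ht h
    exact ht (h.mul hf.continuousAt)
  · exact hq.2.smul_continuous hf

/-- A continuously differentiable solution of `f'' = q f` off `S`. -/
structure IsHillSolution (S : Set ℝ) (q f : ℝ → ℂ) : Prop where
  differentiable : Differentiable ℝ f
  continuous_deriv : Continuous (deriv f)
  ode : ∀ t, t ∉ S → HasDerivAt (deriv f) (q t * f t) t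

/-! ### Hill equations: uniqueness and the Wronskian -/

namespace IsHillSolution

variable {S : Set ℝ} {q f g : ℝ → ℂ}

theorem of_cp (hS : S.Countable) (hf : Cp S 2 f)
    (h : ∀ t, t ∉ S → deriv (deriv f) t = q t * f t) : IsHillSolution S q f := by
  obtain ⟨h1, h2, h3, h4, -⟩ := hf
  exact ⟨differentiable_of_continuous_deriv hS h1 h2 h3, h3,
    fun t ht => h t ht ▸ (h4 t ht).hasDerivAt⟩

theorem cp (hS : FiniteOnIntervals S) (hq : Cp S 0 q) (hf : IsHillSolution S q f) :
    Cp S 2 f :=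
  ⟨hf.differentiable.continuous, fun t _ => hf.differentiable t, hf.continuous_deriv,
    fun t ht => (hf.ode t ht).differentiableAt,
    (hq.mul_continuous hf.differentiable.continuous).congr_zero hS
      fun t ht => (hf.ode t ht).deriv.symm⟩

theorem smul (c : ℂ) (hf : IsHillSolution S q f) : IsHillSolution S q (fun t => c * f t) := by
  have hd : deriv (fun t => c * f t) = fun t => c * deriv f t := by
    funext t
    exact ((hf.differentiable t).hasDerivAt.const_mul c).deriv
  refine ⟨hf.differentiable.const_mul c, ?_, fun t ht => ?_⟩
  · rw [hd]; exact continuous_const.mul hf.continuous_deriv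
  · rw [hd]; exact ((hf.ode t ht).const_mul c).congr_deriv (by ring)

theorem add (hf : IsHillSolution S q f) (hg : IsHillSolution S q g) :
    IsHillSolution S q (fun t => f t + g t) := by
  have hd : deriv (fun t => f t + g t) = fun t => deriv f t + deriv g t := by
    funext t
    exact ((hf.differentiable t).hasDerivAt.add (hg.differentiable t).hasDerivAt).deriv
  refine ⟨hf.differentiable.add hg.differentiable, ?_, fun t ht => ?_⟩
  · rw [hd]; exact hf.continuous_deriv.add hg.continuous_deriv
  · rw [hd]; exact ((hf.ode t ht).add (hg.ode t ht)).congr_deriv (by ring)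

theorem sub_smul (c : ℂ) (hf : IsHillSolution S q f) (hg : IsHillSolution S q g) :
    IsHillSolution S q (fun t => f t - c * g t) := by
  convert hf.add (hg.smul (-c)) using 2; ring

theorem translate (hS : ∀ t, t + 1 ∈ S ↔ t ∈ S) (hq : ∀ t, q (t + 1) = q t)
    (hf : IsHillSolution S q f) : IsHillSolution S q (fun t => f (t + 1)) := by
  have hd : deriv (fun t => f (t + 1)) = fun t => deriv f (t + 1) := by
    funext t
    exact deriv_comp_add_const f 1 t
  refine ⟨fun t => ((hf.differentiable (t + 1)).hasDerivAt.comp_add_const t 1).differentiableAt,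
    ?_, fun t ht => ?_⟩
  · rw [hd]; exact hf.continuous_deriv.comp (continuous_id.add continuous_const)
  · rw [hd, ← hq t]
    exact (hf.ode (t + 1) fun h => ht ((hS t).1 h)).comp_add_const t 1

theorem conj (hq : ∀ t, (q t).im = 0) (hf : IsHillSolution S q f) :
    IsHillSolution S q (fun t => star (f t)) := by
  have hd : deriv (fun t => star (f t)) = fun t => star (deriv f t) := by
    funext t
    exact (hf.differentiable t).hasDerivAt.star.deriv
  refine ⟨fun t => (hf.differentiable t).hasDerivAt.star.differentiableAt, ?_, fun t ht => ?_⟩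
  · rw [hd]; exact hf.continuous_deriv.star
  · rw [hd]
    refine (hf.ode t ht).star.congr_deriv ?_
    rw [star_mul']
    congr 1
    exact Complex.conj_eq_iff_im.2 (hq t)

theorem intervalIntegrable_mul (hq : LocallyIntegrable q) (hf : Continuous f) (a b : ℝ) :
    IntervalIntegrable (fun t => q t * f t) volume a b :=
  ((hq.smul_continuous hf).integrableOn_isCompact isCompact_uIcc).intervalIntegrable

theorem integral_deriv (hS : S.Countable) (hq : LocallyIntegrable q)
    (hf : IsHillSolution S q f) (a b : ℝ) :
    ∫ t in a..b, q t * f t = deriv f b - deriv f a :=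
  integral_eq_of_hasDerivAt_off_countable _ _ hS hf.continuous_deriv.continuousOn
    (fun t ht => hf.ode t ht.2) (intervalIntegrable_mul hq hf.differentiable.continuous a b)

/-- As `q` is merely locally integrable, the classical Lipschitz argument is replaced by an integral
one: near `t₀`, `‖deriv f‖` is at most `max ‖f‖` times `∫ ‖q‖`, so on a short interval `max ‖f‖` is
at most a fraction of itself. -/
theorem eq_zero_near (hS : S.Countable) (hq : LocallyIntegrable q) (hf : IsHillSolution S q f)
    {t₀ : ℝ} (h0 : f t₀ = 0) (h1 : deriv f t₀ = 0) : ∀ᶠ t in 𝓝 t₀, f t = 0 := by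
  set K := Icc (t₀ - 1) (t₀ + 1)
  have hqK : IntegrableOn (fun t => ‖q t‖) K := (hq.integrableOn_isCompact isCompact_Icc).norm
  set Q := ∫ t in K, ‖q t‖
  have hQ : 0 ≤ Q := integral_nonneg fun t => norm_nonneg _
  -- This choice gives `Q * δ < 1` and `δ ≤ 1`, the latter keeping `J` inside `K`.
  set δ := 1 / (Q + 2)
  have hδ : 0 < δ := by positivity
  have hδ1 : δ ≤ 1 := by
    rw [div_le_one (by positivity)]; linarith
  have hQδ : Q * δ < 1 := by
    rw [mul_one_div, div_lt_one (by positivity)]; linarith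
  set J := Icc (t₀ - δ) (t₀ + δ)
  have ht₀ : t₀ ∈ J := ⟨by linarith, by linarith⟩
  obtain ⟨s, hsJ, hs⟩ := isCompact_Icc.exists_isMaxOn (s := J) ⟨t₀, ht₀⟩
    hf.differentiable.continuous.norm.continuousOn
  have hM : ∀ t ∈ J, ‖f t‖ ≤ ‖f s‖ := fun t ht => hs ht
  have hd : ∀ t ∈ J, ‖deriv f t‖ ≤ ‖f s‖ * Q := by
    intro t ht
    have hsubJ : uIoc t₀ t ⊆ J := uIoc_subset_uIcc.trans (ordConnected_Icc.uIcc_subset ht₀ ht)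
    have hsub : uIoc t₀ t ⊆ K := hsubJ.trans (Icc_subset_Icc (by linarith) (by linarith))
    have e := integral_deriv hS hq hf t₀ t
    rw [h1, sub_zero] at e
    rw [← e]
    refine (intervalIntegral.norm_integral_le_integral_norm_uIoc).trans ?_
    have hint : IntegrableOn (fun t => ‖f s‖ * ‖q t‖) (uIoc t₀ t) :=
      (hqK.mono_set hsub).const_mul _
    refine (setIntegral_mono_on ?_ hint measurableSet_uIoc fun u hu => ?_).trans ?_
    · exact ((intervalIntegrable_iff.1
        (intervalIntegrable_mul hq hf.differentiable.continuous t₀ t))).norm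
    · rw [norm_mul, mul_comm]
      exact mul_le_mul_of_nonneg_right (hM u (hsubJ hu)) (norm_nonneg _)
    · rw [integral_const_mul]
      refine mul_le_mul_of_nonneg_left ?_ (norm_nonneg _)
      exact setIntegral_mono_set hqK (ae_of_all _ fun t => norm_nonneg _) hsub.eventuallyLE
  have hs0 : ‖f s‖ = 0 := by
    have := (convex_Icc (t₀ - δ) (t₀ + δ)).norm_image_sub_le_of_norm_deriv_le
      (fun t _ => hf.differentiable t) hd ht₀ hsJ
    rw [h0, sub_zero, Real.norm_eq_abs] at this
    have hsδ : |s - t₀| ≤ δ := abs_le.2 ⟨by linarith [hsJ.1], by linarith [hsJ.2]⟩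
    have h2 : ‖f s‖ ≤ ‖f s‖ * (Q * δ) := by
      rw [← mul_assoc]
      exact this.trans (mul_le_mul_of_nonneg_left hsδ (by positivity))
    nlinarith [norm_nonneg (f s)]
  filter_upwards [Icc_mem_nhds (show t₀ - δ < t₀ by linarith) (show t₀ < t₀ + δ by linarith)]
    with t ht
  exact norm_le_zero_iff.1 (hs0 ▸ hM t ht)

theorem eq_zero (hS : S.Countable) (hq : LocallyIntegrable q) (hf : IsHillSolution S q f)
    {t₀ : ℝ} (h0 : f t₀ = 0) (h1 : deriv f t₀ = 0) (t : ℝ) : f t = 0 := by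
  have hcl : IsClopen {t | f t = 0 ∧ deriv f t = 0} := by
    constructor
    · exact (isClosed_eq hf.differentiable.continuous continuous_const).inter
        (isClosed_eq hf.continuous_deriv continuous_const)
    · rw [isOpen_iff_mem_nhds]
      intro u hu
      filter_upwards [(eq_zero_near hS hq hf hu.1 hu.2).eventually_nhds] with v hv
      refine ⟨hv.self_of_nhds, ?_⟩
      have : f =ᶠ[𝓝 v] fun _ => 0 := hv
      rw [this.deriv_eq, deriv_const]
  have := hcl.eq_univ ⟨t₀, h0, h1⟩
  exact (this.symm ▸ mem_univ t : t ∈ {t | f t = 0 ∧ deriv f t = 0}).1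

/-- The Wronskian. -/
noncomputable def wronskian (f g : ℝ → ℂ) (t : ℝ) : ℂ := f t * deriv g t - deriv f t * g t

theorem wronskian_eq (hS : S.Countable) (hf : IsHillSolution S q f) (hg : IsHillSolution S q g)
    (a b : ℝ) : wronskian f g a = wronskian f g b := by
  have hc : Continuous (wronskian f g) :=
    (hf.differentiable.continuous.mul hg.continuous_deriv).sub
      (hf.continuous_deriv.mul hg.differentiable.continuous)
  have := integral_eq_of_hasDerivAt_off_countable (wronskian f g) (fun _ => 0) (a := a) (b := b)
    hS hc.continuousOn (fun t ht => by
      exact (((hf.differentiable t).hasDerivAt.mul (hg.ode t ht.2)).sub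
        ((hf.ode t ht.2).mul (hg.differentiable t).hasDerivAt)).congr_deriv (by ring)) (by simp)
  rw [intervalIntegral.integral_zero] at this
  exact (sub_eq_zero.1 this.symm).symm

/-- A solution is determined by its Cauchy data. -/
theorem eq_of_cauchy (hS : S.Countable) (hq : LocallyIntegrable q) (hf : IsHillSolution S q f)
    (hg : IsHillSolution S q g) {t₀ : ℝ} (h0 : f t₀ = g t₀) (h1 : deriv f t₀ = deriv g t₀)
    (t : ℝ) : f t = g t := by
  have hd : deriv (fun t => f t - 1 * g t) t₀ = deriv f t₀ - 1 * deriv g t₀ :=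
    ((hf.differentiable t₀).hasDerivAt.sub
      ((hg.differentiable t₀).hasDerivAt.const_mul 1)).deriv
  have := (hf.sub_smul 1 hg).eq_zero hS hq (t₀ := t₀) (by simp [h0]) (by rw [hd, h1]; ring) t
  simpa [sub_eq_zero] using this

theorem deriv_smul (hf : IsHillSolution S q f) (c : ℂ) (t : ℝ) :
    deriv (fun t => c * f t) t = c * deriv f t :=
  ((hf.differentiable t).hasDerivAt.const_mul c).deriv

theorem deriv_add (hf : IsHillSolution S q f) (hg : IsHillSolution S q g) (t : ℝ) :
    deriv (fun t => f t + g t) t = deriv f t + deriv g t :=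
  ((hf.differentiable t).hasDerivAt.add (hg.differentiable t).hasDerivAt).deriv

theorem exists_eq_smul (hS : S.Countable) (hq : LocallyIntegrable q) (hf : IsHillSolution S q f)
    (hg : IsHillSolution S q g) (hne : ∃ t, f t ≠ 0) {t₀ : ℝ} (hw : wronskian f g t₀ = 0) :
    ∃ c : ℂ, ∀ t, g t = c * f t := by
  unfold wronskian at hw
  by_cases h0 : f t₀ = 0
  · have h1 : deriv f t₀ ≠ 0 := fun h1 => by
      obtain ⟨t, ht⟩ := hne
      exact ht (hf.eq_zero hS hq h0 h1 t)
    refine ⟨deriv g t₀ / deriv f t₀, hg.eq_of_cauchy hS hq (hf.smul _) (t₀ := t₀) ?_ ?_⟩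
    · simpa [h0, h1] using hw
    · rw [hf.deriv_smul, div_mul_cancel₀ _ h1]
  · refine ⟨g t₀ / f t₀, hg.eq_of_cauchy hS hq (hf.smul _) (t₀ := t₀) ?_ ?_⟩
    · rw [div_mul_cancel₀ _ h0]
    · rw [hf.deriv_smul]
      field_simp
      linear_combination hw

/-- Cramer's rule for the Cauchy data at `t₀`. -/
theorem exists_eq_combination (hS : S.Countable) (hq : LocallyIntegrable q)
    {h : ℝ → ℂ} (hf : IsHillSolution S q f) (hg : IsHillSolution S q g)
    (hh : IsHillSolution S q h) {t₀ : ℝ} (hw : wronskian f g t₀ ≠ 0) :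
    ∃ a b : ℂ, ∀ t, h t = a * f t + b * g t := by
  unfold wronskian at hw
  refine ⟨(h t₀ * deriv g t₀ - deriv h t₀ * g t₀) / (f t₀ * deriv g t₀ - deriv f t₀ * g t₀),
    (f t₀ * deriv h t₀ - deriv f t₀ * h t₀) / (f t₀ * deriv g t₀ - deriv f t₀ * g t₀),
    hh.eq_of_cauchy hS hq ((hf.smul _).add (hg.smul _)) (t₀ := t₀) ?_ ?_⟩
  · rw [div_mul_eq_mul_div, div_mul_eq_mul_div, ← add_div, eq_div_iff hw]
    ring
  · rw [(hf.smul _).deriv_add (hg.smul _), hf.deriv_smul, hg.deriv_smul,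
      div_mul_eq_mul_div, div_mul_eq_mul_div, ← add_div, eq_div_iff hw]
    ring

end IsHillSolution

/-! ### Multipliers of bounded functions -/

theorem apply_add_nat {f : ℝ → ℂ} {c : ℂ} (hf : ∀ t, f (t + 1) = c * f t) (n : ℕ) (t : ℝ) :
    f (t + n) = c ^ n * f t := by
  induction n with
  | zero => simp
  | succ n ih =>
    rw [Nat.cast_succ, ← add_assoc, hf, ih]
    ring

theorem apply_add_int {f : ℝ → ℂ} {c : ℂ} (hc : c ≠ 0) (hf : ∀ t, f (t + 1) = c * f t)
    (n : ℤ) (t : ℝ) : f (t + n) = c ^ n * f t := by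
  obtain ⟨m, rfl | rfl⟩ := n.eq_nat_or_neg
  · simpa using apply_add_nat hf m t
  · have := apply_add_nat hf m (t - m)
    rw [sub_add_cancel] at this
    rw [this, zpow_neg, zpow_natCast, Int.cast_neg, Int.cast_natCast, ← sub_eq_add_neg,
      inv_mul_cancel_left₀ (pow_ne_zero _ hc)]

theorem norm_le_one_of_bounded_pow {c a : ℂ} {C : ℝ} (ha : a ≠ 0) (h : ∀ n : ℕ, ‖c ^ n * a‖ ≤ C) :
    ‖c‖ ≤ 1 := by
  by_contra! hc
  obtain ⟨n, hn⟩ := pow_unbounded_of_one_lt (C / ‖a‖) hc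
  have := h n
  rw [norm_mul, norm_pow] at this
  rw [div_lt_iff₀ (norm_pos_iff.2 ha)] at hn
  linarith

/-- The multiplier of a bounded Bloch function has modulus one. -/
theorem norm_multiplier_eq_one {f : ℝ → ℂ} {c : ℂ} {C : ℝ} (hf : ∀ t, f (t + 1) = c * f t)
    (hb : ∀ t, ‖f t‖ ≤ C) (hne : ∃ t, f t ≠ 0) : ‖c‖ = 1 := by
  obtain ⟨t, ht⟩ := hne
  have hc : c ≠ 0 := by
    rintro rfl
    have := hf (t - 1)
    rw [sub_add_cancel, zero_mul] at this
    exact ht this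
  apply le_antisymm
  · exact norm_le_one_of_bounded_pow ht fun n => apply_add_nat hf n t ▸ hb _
  · have : ‖c⁻¹‖ ≤ 1 := norm_le_one_of_bounded_pow (C := C) ht fun n => by
      have := apply_add_int hc hf (-n) t
      rw [zpow_neg, zpow_natCast, ← inv_pow] at this
      exact this ▸ hb _
    rw [norm_inv] at this
    exact (inv_le_one₀ (norm_pos_iff.2 hc)).1 this

theorem exp_I_mul_eq_one_or_neg_one (m : ℤ) :
    Complex.exp (Complex.I * ((m * Real.pi : ℝ) : ℂ)) = 1 ∨
      Complex.exp (Complex.I * ((m * Real.pi : ℝ) : ℂ)) = -1 := by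
  rw [← sq_eq_one_iff, ← Complex.exp_nat_mul, Complex.exp_eq_one_iff]
  exact ⟨m, by push_cast; ring⟩

/-! ### Bloch decomposition in one dimension -/

namespace IsHillSolution

variable {S : Set ℝ} {q f g : ℝ → ℂ}

/-- A bounded Bloch solution can only exist if a constant imaginary part of the potential
vanishes. -/
theorem im_eq_zero_of_multiplier (hS : S.Countable) (hf : IsHillSolution S q f)
    (hne : ∃ t, f t ≠ 0) {c : ℂ} (hc : ‖c‖ = 1) (hfc : ∀ t, f (t + 1) = c * f t) {y : ℝ}
    (hy : ∀ t, (q t).im = y) : y = 0 := by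
  obtain ⟨a, ha⟩ := hne
  have hfc' (t : ℝ) : deriv f (t + 1) = c * deriv f t := by
    rw [← deriv_comp_add_const, ← hf.deriv_smul c, funext hfc]
  have hcc : c * star c = 1 := by
    rw [Complex.star_def, Complex.mul_conj, Complex.normSq_eq_norm_sq, hc]; simp
  have hcont : Continuous fun t => f t * star (deriv f t) - deriv f t * star (f t) :=
    (hf.differentiable.continuous.mul hf.continuous_deriv.star).sub
      (hf.continuous_deriv.mul hf.differentiable.continuous.star)
  have hcn : Continuous fun t => ‖f t‖ ^ 2 := hf.differentiable.continuous.norm.pow 2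
  -- The Wronskian of `f` with its conjugate has derivative `-2iy‖f‖²`, and it is periodic because
  -- `‖c‖ = 1`.
  have key := integral_eq_of_hasDerivAt_off_countable
    (fun t => f t * star (deriv f t) - deriv f t * star (f t))
    (fun t => (-2 * y * Complex.I) * ((‖f t‖ ^ 2 : ℝ) : ℂ)) (a := a) (b := a + 1) hS
    hcont.continuousOn (fun t ht => by
      refine (((hf.differentiable t).hasDerivAt.mul (hf.ode t ht.2).star).sub
        ((hf.ode t ht.2).mul (hf.differentiable t).hasDerivAt.star)).congr_deriv ?_
      have h1 : f t * star (f t) = ((‖f t‖ ^ 2 : ℝ) : ℂ) := by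
        rw [Complex.star_def, Complex.mul_conj, Complex.normSq_eq_norm_sq]
      have h2 : q t - star (q t) = 2 * y * Complex.I := by
        rw [Complex.star_def, Complex.sub_conj, hy]; push_cast; ring
      rw [star_mul', ← h1]
      linear_combination -(f t * star (f t)) * h2)
    ((continuous_const.mul (Complex.continuous_ofReal.comp hcn)).intervalIntegrable _ _)
  have hW : f (a + 1) * star (deriv f (a + 1)) - deriv f (a + 1) * star (f (a + 1)) -
      (f a * star (deriv f a) - deriv f a * star (f a)) = 0 := by
    rw [hfc, hfc', star_mul', star_mul']
    linear_combination (f a * star (deriv f a) - deriv f a * star (f a)) * hcc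
  rw [hW, intervalIntegral.integral_const_mul, intervalIntegral.integral_ofReal] at key
  have hpos : 0 < ∫ t in a..a + 1, ‖f t‖ ^ 2 :=
    intervalIntegral.integral_pos (by linarith) hcn.continuousOn (fun t _ => by positivity)
      ⟨a, ⟨le_refl a, by linarith⟩, by positivity⟩
  rcases mul_eq_zero.1 key with h | h
  · simpa using h
  · exact absurd (Complex.ofReal_eq_zero.1 h) hpos.ne'

/-- The Bloch decomposition of a bounded solution `ψ` of a Hill equation, in the form needed for
tensor products: either `ψ` is periodic or antiperiodic, or it is a combination of two Bloch
solutions with opposite quasimomenta, and in any case these vanish at the common zeros of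
`ψ` and of its translate. -/
theorem exists_bloch_pair (hS : S.Countable) (hSper : ∀ t, t + 1 ∈ S ↔ t ∈ S)
    (hq : LocallyIntegrable q) (hqper : ∀ t, q (t + 1) = q t) {y : ℝ} (hy : ∀ t, (q t).im = y)
    {ψ : ℝ → ℂ} (hψ : IsHillSolution S q ψ) (hne : ∃ t, ψ t ≠ 0) {C : ℝ} (hb : ∀ t, ‖ψ t‖ ≤ C) :
    ∃ (k : ℝ) (F : Bool → ℝ → ℂ) (a : Bool → ℂ),
      k ∈ Icc (-Real.pi) Real.pi ∧
      (∀ b, IsHillSolution S q (F b) ∧ (∃ t, F b t ≠ 0) ∧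
        ∀ t, F b (t + 1) = Complex.exp (Complex.I * ((bif b then k else -k : ℝ) : ℂ)) * F b t) ∧
      (∀ b t, F b t ≠ 0 → ψ t ≠ 0 ∨ ψ (t + 1) ≠ 0) ∧
      ((F true = ψ ∧ ∃ m : ℤ, k = m * Real.pi) ∨
        ((∀ t, ψ t = ∑ b, a b * F b t) ∧ ¬ ∃ m : ℤ, k = m * Real.pi)) := by
  have hT := hψ.translate hSper hqper
  -- a multiplier of modulus one, written in exponential form
  have hexp (c : ℂ) (hc : ‖c‖ = 1) : Complex.exp (Complex.I * (c.arg : ℂ)) = c ∧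
      Complex.exp (Complex.I * ((-c.arg : ℝ) : ℂ)) = star c := by
    have h1 : Complex.exp (Complex.I * (c.arg : ℂ)) = c := by
      have := Complex.norm_mul_exp_arg_mul_I c
      rwa [hc, Complex.ofReal_one, one_mul, mul_comm] at this
    refine ⟨h1, ?_⟩
    conv_rhs => rw [← h1]
    rw [Complex.star_def, ← Complex.exp_conj]
    simp
  -- distinct Bloch solutions
  have pair (c : ℂ) (hc : ‖c‖ = 1) (hc1 : c ≠ 1) (hc2 : c ≠ -1) (f g : ℝ → ℂ)
      (hf : IsHillSolution S q f) (hg : IsHillSolution S q g) (hf0 : ∃ t, f t ≠ 0)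
      (hg0 : ∃ t, g t ≠ 0) (hfc : ∀ t, f (t + 1) = c * f t)
      (hgc : ∀ t, g (t + 1) = star c * g t) (hz : ∀ t, ψ t ≠ 0 ∨ ψ (t + 1) ≠ 0) (α β : ℂ)
      (hψe : ∀ t, ψ t = α * f t + β * g t) : ∃ (k : ℝ) (F : Bool → ℝ → ℂ) (a : Bool → ℂ),
      k ∈ Icc (-Real.pi) Real.pi ∧
      (∀ b, IsHillSolution S q (F b) ∧ (∃ t, F b t ≠ 0) ∧
        ∀ t, F b (t + 1) = Complex.exp (Complex.I * ((bif b then k else -k : ℝ) : ℂ)) * F b t) ∧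
      (∀ b t, F b t ≠ 0 → ψ t ≠ 0 ∨ ψ (t + 1) ≠ 0) ∧
      ((F true = ψ ∧ ∃ m : ℤ, k = m * Real.pi) ∨
        ((∀ t, ψ t = ∑ b, a b * F b t) ∧ ¬ ∃ m : ℤ, k = m * Real.pi)) := by
    refine ⟨c.arg, fun b => bif b then f else g, fun b => bif b then α else β,
      ⟨(Complex.neg_pi_lt_arg c).le, Complex.arg_le_pi c⟩, ?_, fun _ t _ => hz t,
      Or.inr ⟨fun t => by simp [hψe], ?_⟩⟩
    · rintro (_ | _)
      · exact ⟨hg, hg0, fun t => by simpa only [cond_false, (hexp c hc).2] using hgc t⟩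
      · exact ⟨hf, hf0, fun t => by simpa only [cond_true, (hexp c hc).1] using hfc t⟩
    · rintro ⟨m, hm⟩
      have h1 := (hexp c hc).1
      rw [hm] at h1
      rcases exp_I_mul_eq_one_or_neg_one m with h | h
      · exact hc1 (h1 ▸ h)
      · exact hc2 (h1 ▸ h)
  by_cases hw : wronskian ψ (fun t => ψ (t + 1)) 0 = 0
  · obtain ⟨c, hc⟩ := hψ.exists_eq_smul hS hq hT hne hw
    have hcn := norm_multiplier_eq_one hc hb hne
    by_cases hc2 : c = 1 ∨ c = -1
    · obtain ⟨k, m, hk, hkI, hkc, hkc'⟩ : ∃ (k : ℝ) (m : ℤ), k = m * Real.pi ∧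
          k ∈ Icc (-Real.pi) Real.pi ∧ Complex.exp (Complex.I * (k : ℂ)) = c ∧
          Complex.exp (Complex.I * ((-k : ℝ) : ℂ)) = c := by
        have hI : c.arg ∈ Icc (-Real.pi) Real.pi :=
          ⟨(Complex.neg_pi_lt_arg c).le, Complex.arg_le_pi c⟩
        have hs : star c = c := by rcases hc2 with rfl | rfl <;> simp
        rcases hc2 with rfl | rfl
        · exact ⟨_, 0, by simp, hI, (hexp _ hcn).1, (hexp _ hcn).2.trans hs⟩
        · exact ⟨_, 1, by simp [Complex.arg_neg_one], hI, (hexp _ hcn).1,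
            (hexp _ hcn).2.trans hs⟩
      -- Here `k` is `0` or `π`, so `k` and `-k` give the same multiplier and `ψ` serves for both
      -- signs. The coefficients are placeholders, since the first alternative is proved.
      refine ⟨k, fun _ => ψ, fun _ => 0, hkI, ?_, fun _ t ht => Or.inl ht, Or.inl ⟨rfl, m, hk⟩⟩
      rintro (_ | _)
      · exact ⟨hψ, hne, fun t => by rw [cond_false, hkc']; exact hc t⟩
      · exact ⟨hψ, hne, fun t => by rw [cond_true, hkc]; exact hc t⟩
    · rw [not_or] at hc2
      have hreal : ∀ t, (q t).im = 0 := fun t =>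
        (hy t).trans (hψ.im_eq_zero_of_multiplier hS hne hcn hc hy)
      have hconj := hψ.conj hreal
      refine pair c hcn hc2.1 hc2.2 ψ _ hψ hconj hne ?_ hc (fun t => ?_) (fun t => Or.inl ?_)
        1 0 (fun t => by simp)
      · obtain ⟨t, ht⟩ := hne
        exact ⟨t, star_ne_zero.2 ht⟩
      · rw [hc, star_mul']
      -- At a zero of `ψ` its Wronskian with the conjugate vanishes. Proportionality would then
      -- force `star c = c`, hence `c = ±1`; so `ψ` has no zeros.
      · intro ht
        obtain ⟨e, he⟩ := hψ.exists_eq_smul hS hq hconj hne (t₀ := t) (by simp [wronskian, ht])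
        obtain ⟨u, hu⟩ := hne
        have h1 := he (u + 1)
        rw [hc, star_mul', he u] at h1
        have heu : e * ψ u ≠ 0 := he u ▸ star_ne_zero.2 hu
        have hcc : star c = c := mul_right_cancel₀ heu (by linear_combination h1)
        have hcc' : c * star c = 1 := by
          rw [Complex.star_def, Complex.mul_conj, Complex.normSq_eq_norm_sq, hcn]; simp
        rw [hcc, ← sq, sq_eq_one_iff] at hcc'
        exact hcc'.elim hc2.1 hc2.2
  · obtain ⟨a, b, hab⟩ := hψ.exists_eq_combination hS hq hT (hT.translate hSper hqper) hw
    have hwall (t : ℝ) : wronskian ψ (fun t => ψ (t + 1)) t ≠ 0 :=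
      hψ.wronskian_eq hS hT 0 t ▸ hw
    have hd (t : ℝ) : deriv (fun t => ψ (t + 1)) t = deriv ψ (t + 1) := deriv_comp_add_const ψ 1 t
    have hd2 : deriv ψ (0 + 1 + 1) = a * deriv ψ 0 + b * deriv ψ (0 + 1) := by
      have h1 : deriv (fun t => ψ (t + 1 + 1)) 0 = deriv ψ (0 + 1 + 1) := by
        rw [deriv_comp_add_const (fun t => ψ (t + 1)) 1 0, hd]
      rw [← h1, ← hd 0, funext hab, (hψ.smul a).deriv_add (hT.smul b), hψ.deriv_smul,
        hT.deriv_smul]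
    -- The Wronskian of `Tψ` and `T²ψ = aψ + bTψ` is `-a` times that of `ψ` and `Tψ`, yet the two
    -- are equal.
    have ha : a = -1 := by
      have h1 := hψ.wronskian_eq hS hT 0 (0 + 1)
      have h2 := hab 0
      unfold wronskian at h1 hw
      simp only [hd] at h1 hw
      rw [hd2, h2] at h1
      refine mul_right_cancel₀ hw ?_
      linear_combination h1
    subst ha
    -- The roots of `x² - bx + 1`, the characteristic polynomial of `T` on the span of `ψ` and `Tψ`.
    obtain ⟨ρ, σ, hρσ, hsum⟩ : ∃ ρ σ : ℂ, ρ * σ = 1 ∧ ρ + σ = b := by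
      obtain ⟨s, hs⟩ := IsAlgClosed.exists_eq_mul_self (b ^ 2 - 4)
      exact ⟨(b + s) / 2, (b - s) / 2, by linear_combination hs / 4, by ring⟩
    -- eigenvectors of the translation
    have eig (ρ σ : ℂ) (hρσ : ρ * σ = 1) (hsum : ρ + σ = b) :
        (∃ t, ψ (t + 1) - σ * ψ t ≠ 0) ∧
        (∀ t, ψ (t + 1 + 1) - σ * ψ (t + 1) = ρ * (ψ (t + 1) - σ * ψ t)) ∧ ‖ρ‖ = 1 := by
      have h1 : ∃ t, ψ (t + 1) - σ * ψ t ≠ 0 := by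
        by_contra! h
        have h' : (fun t => ψ (t + 1)) = fun t => σ * ψ t := funext fun t => sub_eq_zero.1 (h t)
        apply hw
        rw [h']
        simp only [wronskian, hψ.deriv_smul]
        ring
      have h2 : ∀ t, ψ (t + 1 + 1) - σ * ψ (t + 1) = ρ * (ψ (t + 1) - σ * ψ t) := fun t => by
        rw [hab t]
        linear_combination ψ t * hρσ - ψ (t + 1) * hsum
      refine ⟨h1, h2, norm_multiplier_eq_one (f := fun t => ψ (t + 1) - σ * ψ t)
        (C := C + ‖σ‖ * C) h2 (fun t => ?_) h1⟩
      refine (norm_sub_le _ _).trans (add_le_add (hb _) ?_)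
      rw [norm_mul]
      exact mul_le_mul_of_nonneg_left (hb t) (norm_nonneg _)
    obtain ⟨hf0, hfc, hρ⟩ := eig ρ σ hρσ hsum
    obtain ⟨hg0, hgc, -⟩ := eig σ ρ (by rw [mul_comm, hρσ]) (by rw [add_comm, hsum])
    have hρ0 : ρ ≠ 0 := left_ne_zero_of_mul_eq_one hρσ
    have hσ : σ = star ρ := by
      refine mul_left_cancel₀ hρ0 ?_
      rw [hρσ, Complex.star_def, Complex.mul_conj, Complex.normSq_eq_norm_sq, hρ]
      simp
    -- a nontrivial Jordan block would produce linear growth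
    have hρ2 : ρ * ρ ≠ 1 := by
      intro h
      have hσρ : σ = ρ := mul_left_cancel₀ hρ0 (by rw [h, hρσ])
      subst hσρ
      obtain ⟨t, ht⟩ := hf0
      -- Iteration of the Jordan block; the extra factor `σ` avoids the exponent `n - 1`.
      have hgrow (n : ℕ) : σ * ψ (t + n) =
          σ ^ (n + 1) * ψ t + n * (σ ^ n * (ψ (t + 1) - σ * ψ t)) := by
        induction n with
        | zero => simp
        | succ n ih =>
          have h3 := apply_add_nat (f := fun t => ψ (t + 1) - σ * ψ t) hfc n t
          push_cast
          rw [← add_assoc]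
          linear_combination σ * ih + σ * h3
      obtain ⟨n, hn⟩ := exists_nat_gt (2 * C / ‖ψ (t + 1) - σ * ψ t‖)
      rw [div_lt_iff₀ (norm_pos_iff.2 ht)] at hn
      have h4 : n * (σ ^ n * (ψ (t + 1) - σ * ψ t)) = σ * ψ (t + n) - σ ^ (n + 1) * ψ t := by
        rw [hgrow n]; ring
      have h5 := congrArg norm h4
      rw [norm_mul, norm_mul, norm_pow, hρ, one_pow, one_mul, Complex.norm_natCast] at h5
      have h6 := norm_sub_le (σ * ψ (t + n)) (σ ^ (n + 1) * ψ t)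
      rw [norm_mul, norm_mul, norm_pow, hρ, one_pow, one_mul, one_mul] at h6
      linarith [hb t, hb (t + n)]
    have hne' : ρ - σ ≠ 0 := fun h => hρ2 (by rw [sub_eq_zero.1 h] at hρσ ⊢; exact hρσ)
    -- The coefficients come from `(Tψ - σψ) - (Tψ - ρψ) = (ρ - σ)ψ`.
    refine pair ρ hρ (fun h => hρ2 (by rw [h]; ring)) (fun h => hρ2 (by rw [h]; ring)) _ _
      (hT.sub_smul σ hψ) (hT.sub_smul ρ hψ) hf0 hg0 hfc (hσ ▸ hgc) (fun t => ?_)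
      (1 / (ρ - σ)) (-1 / (ρ - σ)) (fun t => ?_)
    · by_contra! h
      exact hwall t (by simp [wronskian, h.1, h.2])
    · field_simp
      ring

end IsHillSolution

/-! ### Products and separation of variables -/

theorem Cp.const_mul {S : Set ℝ} (c : ℂ) (l : ℕ) {f : ℝ → ℂ} (hf : Cp S l f) :
    Cp S l (fun t => c * f t) := by
  induction l generalizing f with
  | zero =>
    refine ⟨hf.1.mono fun t ht h => ht (continuousAt_const.mul h), ?_⟩
    exact hf.2.smul c
  | succ l ih =>
    refine ⟨continuous_const.mul hf.1, fun t ht => (hf.2.1 t ht).const_mul c, ?_⟩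
    have : deriv (fun t => c * f t) = fun t => c * deriv f t := by
      funext t
      exact deriv_const_mul_field c
    rw [this]
    exact ih hf.2.2

theorem Cp.two_mul_ofReal_sub {S : Set ℝ} {v : ℝ → ℝ} (hv : Cp S 0 v) (z : ℂ) :
    Cp S 0 (fun t => 2 * (v t : ℂ) - z) := by
  refine ⟨hv.1.mono fun t ht h => ht ?_, ?_⟩
  · exact (continuousAt_const.mul (Complex.continuous_ofReal.continuousAt.comp h)).sub
      continuousAt_const
  · have : LocallyIntegrable (fun t => (v t : ℂ)) :=
      hv.2.mono (Complex.continuous_ofReal.comp_aestronglyMeasurable hv.2.aestronglyMeasurable)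
        (ae_of_all _ fun t => by simp)
    exact (this.smul (2 : ℂ)).sub (locallyIntegrable_const z)

section Product

variable {d : ℕ} (f : Fin d → ℝ → ℂ) (x : Fin d → ℝ) (j : Fin d)

theorem slice_prod : slice (fun x => ∏ i, f i (x i)) x j =
    fun t => (∏ i ∈ Finset.univ.erase j, f i (x i)) * f j t := by
  funext t
  change ∏ i, f i (Function.update x j t i) = _
  rw [← Finset.mul_prod_erase _ _ (Finset.mem_univ j), mul_comm, Function.update_self]
  congr 1
  refine Finset.prod_congr rfl fun i hi => ?_
  rw [Function.update_of_ne (Finset.ne_of_mem_erase hi)]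

theorem laplacian_prod : laplacian (fun x => ∏ i, f i (x i)) x =
    ∑ j, (∏ i ∈ Finset.univ.erase j, f i (x i)) * deriv (deriv (f j)) (x j) := by
  unfold laplacian
  refine Finset.sum_congr rfl fun j _ => ?_
  rw [slice_prod]
  have (c : ℂ) (g : ℝ → ℂ) : deriv (fun t => c * g t) = fun t => c * deriv g t := by
    funext t
    exact deriv_const_mul_field c
  rw [this, this]

variable {f x} {E : Fin d → Set ℝ} {q : Fin d → ℝ → ℂ}

theorem laplacian_prod_of_isHillSolution (hf : ∀ j, IsHillSolution (E j) (q j) (f j))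
    (hx : ∀ j, x j ∉ E j) :
    laplacian (fun x => ∏ i, f i (x i)) x = (∑ j, q j (x j)) * ∏ i, f i (x i) := by
  rw [laplacian_prod, Finset.sum_mul]
  refine Finset.sum_congr rfl fun j _ => ?_
  rw [((hf j).ode _ (hx j)).deriv, ← Finset.mul_prod_erase _ _ (Finset.mem_univ j)]
  ring

/-- Separation of variables: products of solutions of Hill equations solve `(*)` when the
potentials add up to `2 (V - lam)` wherever the product does not vanish. -/
theorem isSolution_prod (hE : ∀ j, FiniteOnIntervals (E j)) (hq : ∀ j, Cp (E j) 0 (q j))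
    (hf : ∀ j, IsHillSolution (E j) (q j) (f j)) {V : (Fin d → ℝ) → ℝ} {lam : ℝ}
    (hV : ∀ x : Fin d → ℝ, (∀ j, x j ∉ E j) → (∀ j, f j (x j) ≠ 0) →
      ∑ j, q j (x j) = 2 * ((V x : ℂ) - lam)) :
    IsSolution E V lam (fun x => ∏ i, f i (x i)) := by
  refine ⟨fun x j => ?_, fun x hx => ?_⟩
  · rw [slice_prod]
    exact ((hf j).cp (hE j) (hq j)).const_mul _ 2
  · rw [laplacian_prod_of_isHillSolution hf hx]
    -- The Laplacian is a multiple of the product, so at zeros of the product the equation holds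
    -- whatever `V` is.
    by_cases h : ∀ j, f j (x j) ≠ 0
    · rw [hV x hx h]
      ring
    · push Not at h
      obtain ⟨j, hj⟩ := h
      have h0 : ∏ i, f i (x i) = 0 := Finset.prod_eq_zero (Finset.mem_univ j) hj
      simp [h0]

theorem hasQuasimomentum_prod {k : Fin d → ℝ}
    (hf : ∀ j t, f j (t + 1) = Complex.exp (Complex.I * (k j : ℂ)) * f j t) :
    HasQuasimomentum k (fun x => ∏ i, f i (x i)) := by
  intro n x
  have h : Complex.I * ((∑ j, k j * (n j : ℝ) : ℝ) : ℂ) =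
      ∑ j, (n j : ℂ) * (Complex.I * (k j : ℂ)) := by
    push_cast
    rw [Finset.mul_sum]
    exact Finset.sum_congr rfl fun j _ => by ring
  rw [h, Complex.exp_sum, ← Finset.prod_mul_distrib]
  refine Finset.prod_congr rfl fun j _ => ?_
  rw [Complex.exp_int_mul]
  exact apply_add_int (Complex.exp_ne_zero _) (hf j) (n j) (x j)

/-- A nontrivial separable solution factors into solutions of Hill equations whose potentials have
constant imaginary part. -/
theorem exists_hill_factors (hE : ∀ j, FiniteOnIntervals (E j))
    {V : (Fin d → ℝ) → ℝ}
    (hVper : LatticePeriodic V) (hV : TensorCp E 0 V) {lam : ℝ} {ψ : Fin d → ℝ → ℂ}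
    (hsol : IsSolution E V lam (fun x => ∏ i, ψ i (x i)))
    (hne : ∃ x : Fin d → ℝ, ∏ i, ψ i (x i) ≠ 0)
    (hbdd : ∃ C : ℝ, ∀ x : Fin d → ℝ, ‖∏ i, ψ i (x i)‖ ≤ C) :
    (∀ j, ∃ t, ψ j t ≠ 0) ∧ (∀ j, ∃ C, ∀ t, ‖ψ j t‖ ≤ C) ∧
    ∃ (q : Fin d → ℝ → ℂ) (z : Fin d → ℝ), (∀ j, Cp (E j) 0 (q j)) ∧
      (∀ j t, q j (t + 1) = q j t) ∧ (∀ j t, (q j t).im = z j) ∧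
      (∀ j, IsHillSolution (E j) (q j) (ψ j)) := by
  obtain ⟨x₀, hx₀⟩ := hne
  obtain ⟨C, hC⟩ := hbdd
  rw [Finset.prod_ne_zero_iff] at hx₀
  -- Each factor is a multiple of a slice of the product, and so inherits its regularity and
  -- boundedness.
  have hψs (j : Fin d) : ∃ c : ℂ, ψ j = fun t => c * slice (fun x => ∏ i, ψ i (x i)) x₀ j t := by
    refine ⟨(∏ i ∈ Finset.univ.erase j, ψ i (x₀ i))⁻¹, funext fun t => ?_⟩
    rw [slice_prod, inv_mul_cancel_left₀]
    exact Finset.prod_ne_zero_iff.2 fun i _ => hx₀ i (Finset.mem_univ i)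
  have hcp (j : Fin d) : Cp (E j) 2 (ψ j) := by
    obtain ⟨c, hc⟩ := hψs j
    rw [hc]
    exact (hsol.1 x₀ j).const_mul c 2
  have hy : ∀ j, ∃ t, t ∉ E j ∧ ψ j t ≠ 0 := fun j => by
    obtain ⟨t, h1, h2⟩ := ((hE j).countable.dense_compl ℝ).exists_mem_open
      (isOpen_ne_fun (hcp j).1 continuous_const) ⟨x₀ j, hx₀ j (Finset.mem_univ j)⟩
    exact ⟨t, h1, h2⟩
  choose y hyE hy0 using hy
  refine ⟨fun j => ⟨y j, hy0 j⟩, fun j => ?_, ?_⟩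
  · obtain ⟨c, hc⟩ := hψs j
    refine ⟨‖c‖ * C, fun t => ?_⟩
    rw [hc, norm_mul]
    exact mul_le_mul_of_nonneg_left (hC _) (norm_nonneg _)
  -- With the other coordinates frozen at `y`, dividing the equation by their factors leaves `ψ j''
  -- = (2V - z j) ψ j`. As `V` is real, only `z j` contributes an imaginary part.
  obtain ⟨z, hz⟩ : ∃ z : Fin d → ℂ, ∀ j, z j =
      2 * lam + ∑ i ∈ Finset.univ.erase j, deriv (deriv (ψ i)) (y i) / ψ i (y i) :=
    ⟨_, fun _ => rfl⟩
  refine ⟨fun j t => 2 * ((slice V y j t : ℝ) : ℂ) - z j, fun j => -(z j).im,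
    fun j => (hV y j).two_mul_ofReal_sub (z j), fun j t => ?_, fun j t => ?_, fun j => ?_⟩
  · have h : Function.update y j (t + 1) = Function.update y j t + latticeVec (Pi.single j 1) := by
      funext i
      rcases eq_or_ne i j with rfl | hi
      · simp [latticeVec]
      · simp [latticeVec, hi]
    simp only [slice, h, hVper _ _]
  · simp
  · refine IsHillSolution.of_cp (hE j).countable (hcp j) fun t ht => ?_
    have hx : ∀ i, Function.update y j t i ∉ E i := fun i => by
      rcases eq_or_ne i j with rfl | hi
      · simpa using ht
      · simpa [hi] using hyE i
    have heq := hsol.2 _ hx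
    beta_reduce at heq
    rw [laplacian_prod, ← Finset.add_sum_erase _ _ (Finset.mem_univ j)] at heq
    have hsum : ∑ i ∈ Finset.univ.erase j,
        (∏ l ∈ Finset.univ.erase i, ψ l (Function.update y j t l)) *
          deriv (deriv (ψ i)) (Function.update y j t i) =
        (∑ i ∈ Finset.univ.erase j, deriv (deriv (ψ i)) (y i) / ψ i (y i)) *
          ∏ l, ψ l (Function.update y j t l) := by
      rw [Finset.sum_mul]
      refine Finset.sum_congr rfl fun i hi => ?_
      rw [← Finset.mul_prod_erase _ _ (Finset.mem_univ i),
        Function.update_of_ne (Finset.ne_of_mem_erase hi)]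
      have := hy0 i
      field_simp
    have hP : ∏ l ∈ Finset.univ.erase j, ψ l (Function.update y j t l) ≠ 0 := by
      refine Finset.prod_ne_zero_iff.2 fun l hl => ?_
      rw [Function.update_of_ne (Finset.ne_of_mem_erase hl)]
      exact hy0 l
    rw [hsum, ← Finset.mul_prod_erase _ _ (Finset.mem_univ j), Function.update_self] at heq
    refine mul_left_cancel₀ hP ?_
    simp only [hz, slice]
    linear_combination -2 * heq

end Product

theorem SymmetricAboutAxes.comp_equiv {d : ℕ} {ι κ : Type*} {k : ι → Fin d → ℝ}
    (hk : SymmetricAboutAxes k) (e : κ ≃ ι) : SymmetricAboutAxes (k ∘ e) := by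
  intro j
  obtain ⟨σ, hσ⟩ := hk j
  exact ⟨e.trans (σ.trans e.symm), fun i => by simpa using hσ (e i)⟩

/-! ### Expansion over choices of signs -/

section Signs

variable {d : ℕ} (p : Fin d → Prop) [DecidablePred p]

/-- Extension of a choice of signs by `true`. -/
def extendSigns (e : {j // p j} → Bool) (j : Fin d) : Bool :=
  if h : p j then e ⟨j, h⟩ else true

variable {p}

theorem extendSigns_coe (e : {j // p j} → Bool) (j : {j // p j}) :
    extendSigns p e j = e j := dif_pos j.2

theorem extendSigns_of_not (e : {j // p j} → Bool) {j : Fin d} (hj : ¬ p j) :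
    extendSigns p e j = true := dif_neg hj

theorem prod_eq_sum_extendSigns {ψ : Fin d → ℂ} {F a : Fin d → Bool → ℂ}
    (h : ∀ j, p j → ψ j = ∑ b, a j b * F j b) (h' : ∀ j, ¬ p j → ψ j = F j true) :
    ∏ j, ψ j = ∑ e : {j // p j} → Bool,
      (∏ j : {j // p j}, a j (e j)) * ∏ j, F j (extendSigns p e j) := by
  rw [← Fintype.prod_subtype_mul_prod_subtype p ψ]
  have h1 : ∏ j : {j // p j}, ψ j =
      ∑ e : {j // p j} → Bool, ∏ j : {j // p j}, a j (e j) * F j (e j) := by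
    rw [Finset.prod_congr rfl fun (j : {j // p j}) _ => h j j.2, Finset.prod_univ_sum, Fintype.piFinset_univ]
  rw [h1, Finset.sum_mul]
  refine Finset.sum_congr rfl fun e _ => ?_
  rw [← Fintype.prod_subtype_mul_prod_subtype p fun j => F j (extendSigns p e j),
    Finset.prod_mul_distrib, mul_assoc]
  congr 2
  · exact Finset.prod_congr rfl fun j _ => by rw [extendSigns_coe]
  · exact Finset.prod_congr rfl fun j _ => by rw [extendSigns_of_not _ j.2, h' j j.2]

/-- Reflecting a coordinate in `p` flips its sign choice. In any other coordinate `k j = mπ` differs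
from `-k j` by `2πm`, so the identity permutation works. -/
theorem symmetricAboutAxes_extendSigns {k : Fin d → ℝ}
    (hk : ∀ j, ¬ p j → ∃ m : ℤ, k j = m * Real.pi) :
    SymmetricAboutAxes fun (e : {j // p j} → Bool) j =>
      bif extendSigns p e j then k j else -k j := by
  intro j
  by_cases hj : p j
  · have hinv : Function.Involutive fun e : {j // p j} → Bool =>
        Function.update e ⟨j, hj⟩ (!e ⟨j, hj⟩) := fun e => by simp
    refine ⟨hinv.toPerm, fun e => ⟨0, fun i => ?_⟩⟩
    rcases eq_or_ne i j with rfl | hi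
    · cases h : e ⟨i, hj⟩ <;> simp [reflect, extendSigns, hj, h]
    · by_cases hpi : p i <;> simp [reflect, extendSigns, hi, hpi]
  · obtain ⟨m, hm⟩ := hk j hj
    refine ⟨1, fun e => ⟨Pi.single j m, fun i => ?_⟩⟩
    rcases eq_or_ne i j with rfl | hi
    · simp only [Equiv.Perm.one_apply, reflect, extendSigns_of_not e hj, cond_true,
        Function.update_self, Pi.single_eq_same, hm]
      ring
    · simp [reflect, hi]

/-- Opposite signs at `j` would give `2 k j ∈ 2πℤ`. -/
theorem not_dualCongruent_extendSigns {k : Fin d → ℝ}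
    (hk : ∀ j, p j → ¬ ∃ m : ℤ, k j = m * Real.pi) {e e' : {j // p j} → Bool} (he : e ≠ e') :
    ¬ DualCongruent (fun j => bif extendSigns p e j then k j else -k j)
      (fun j => bif extendSigns p e' j then k j else -k j) := by
  rintro ⟨m, hm⟩
  obtain ⟨j, hj⟩ := Function.ne_iff.1 he
  have h := hm j
  refine hk j j.2 ?_
  simp only [extendSigns_coe] at h
  cases h1 : e j <;> cases h2 : e' j <;> simp only [h1, h2, cond_true, cond_false] at h
  · exact absurd (h1.trans h2.symm) hj
  · exact ⟨-m j, by push_cast; linarith⟩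
  · exact ⟨m j, by linarith⟩
  · exact absurd (h1.trans h2.symm) hj

end Signs

end PeriodicSchrodinger

/-! ### Assembly of the Bloch solutions -/

open PeriodicSchrodinger in
theorem mainTheorem7 (d : ℕ) (hd : 1 ≤ d)
    (E : Fin d → Set ℝ)
    (hEfin : ∀ j, PeriodicSchrodinger.FiniteOnIntervals (E j))
    (hEper : ∀ (j : Fin d) (t : ℝ), t + 1 ∈ E j ↔ t ∈ E j)
    (V : (Fin d → ℝ) → ℝ)
    (hVper : PeriodicSchrodinger.LatticePeriodic V)
    (hV : PeriodicSchrodinger.TensorCp E 0 V)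
    (lam : ℝ) (Ψ : (Fin d → ℝ) → ℂ)
    (hsol : PeriodicSchrodinger.IsSolution E V lam Ψ)
    (hne : ∃ x, Ψ x ≠ 0)
    (hsep : PeriodicSchrodinger.IsSeparable Ψ)
    (hbdd : ∃ C : ℝ, ∀ x, ‖Ψ x‖ ≤ C) :
    ∃ s : ℕ, 1 ≤ s ∧ s ≤ d ∧
      ∃ (Φ : Fin (2 ^ s) → (Fin d → ℝ) → ℂ) (k : Fin (2 ^ s) → Fin d → ℝ)
        (c : Fin (2 ^ s) → ℂ),
        (∀ i, PeriodicSchrodinger.IsSolution E V lam (Φ i) ∧ (∃ x, Φ i x ≠ 0) ∧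
          PeriodicSchrodinger.HasQuasimomentum (k i) (Φ i)) ∧
        (∀ x, Ψ x = ∑ i, c i * Φ i x) ∧
        (∀ i j, k i j ∈ Set.Icc (-Real.pi) Real.pi) ∧
        PeriodicSchrodinger.SymmetricAboutAxes k ∧
        ((∀ i i', i ≠ i' → ¬ PeriodicSchrodinger.DualCongruent (k i) (k i')) ∨
          (s = 1 ∧ ∀ i j, ∃ m : ℤ, k i j = (m : ℝ) * Real.pi)) := by
  classical
  obtain ⟨ψ, hψ⟩ := hsep
  obtain rfl : Ψ = fun x => ∏ j, ψ j (x j) := funext hψ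
  clear hψ
  obtain ⟨hψne, hψb, q, z, hqc, hqper, hqim, hhill⟩ :=
    exists_hill_factors hEfin hVper hV hsol hne hbdd
  have hpair := fun j => (hhill j).exists_bloch_pair (hEfin j).countable (hEper j) (hqc j).2
    (hqper j) (hqim j) (hψne j) (hψb j).choose_spec
  choose k F a hkI hF hz hor using hpair
  have hbloch (ε : Fin d → Bool) : IsSolution E V lam (fun x => ∏ j, F j (ε j) (x j)) ∧
      (∃ x : Fin d → ℝ, ∏ j, F j (ε j) (x j) ≠ 0) ∧
      HasQuasimomentum (fun j => bif ε j then k j else -k j)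
        (fun x => ∏ j, F j (ε j) (x j)) := by
    refine ⟨isSolution_prod hEfin hqc (fun j => (hF j (ε j)).1) fun x hx hx0 => ?_, ?_,
      hasQuasimomentum_prod fun j => (hF j (ε j)).2.2⟩
    -- Shifting each coordinate by 0 or 1 reaches a point where `Ψ` is nonzero. There the equation
    -- yields the sum of the `q j`, which periodicity carries back to `x`.
    · have hn : ∀ j, ∃ n : ℤ, ψ j (x j + n) ≠ 0 ∧ x j + n ∉ E j ∧ q j (x j + n) = q j (x j) := by
        intro j
        rcases hz j (ε j) (x j) (hx0 j) with h | h
        · exact ⟨0, by simpa using h, by simpa using hx j, by simp⟩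
        · exact ⟨1, by simpa using h, by simpa [hEper] using hx j, by simp [hqper]⟩
      choose n hn0 hnE hnq using hn
      have heq := hsol.2 (x + latticeVec n) hnE
      rw [laplacian_prod_of_isHillSolution (x := x + latticeVec n) hhill hnE, hVper n x] at heq
      have hP : ∏ j, ψ j ((x + latticeVec n) j) ≠ 0 :=
        Finset.prod_ne_zero_iff.2 fun j _ => hn0 j
      rw [← Finset.sum_congr rfl fun j _ => hnq j]
      refine mul_right_cancel₀ hP ?_
      change (∑ j, q j ((x + latticeVec n) j)) * _ = _
      linear_combination -2 * heq
    · choose t ht using fun j => (hF j (ε j)).2.1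
      exact ⟨t, Finset.prod_ne_zero_iff.2 fun j _ => ht j⟩
  have hsign (j : Fin d) (b : Bool) : (bif b then k j else -k j) ∈ Icc (-Real.pi) Real.pi := by
    cases b
    · exact ⟨neg_le_neg (hkI j).2, neg_le.1 (hkI j).1⟩
    · exact hkI j
  let p : Fin d → Prop := fun j => ¬ ∃ m : ℤ, k j = m * Real.pi
  have hnp (j : Fin d) (hj : ¬ p j) : F j true = ψ j := by
    rcases hor j with h | h
    · exact h.1
    · exact absurd h.2 hj
  have hp (j : Fin d) (hj : p j) (t : ℝ) : ψ j t = ∑ b, a j b * F j b t := by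
    rcases hor j with h | h
    · exact absurd h.2 hj
    · exact h.1 t
  by_cases hall : ∃ j, p j
  · obtain ⟨j₀, hj₀⟩ := hall
    let e : Fin (2 ^ Fintype.card {j // p j}) ≃ ({j // p j} → Bool) :=
      Fintype.equivOfCardEq (by simp)
    refine ⟨Fintype.card {j // p j}, Fintype.card_pos_iff.2 ⟨⟨j₀, hj₀⟩⟩,
      (Fintype.card_subtype_le p).trans (Fintype.card_fin d).le,
      fun i x => ∏ j, F j (extendSigns p (e i) j) (x j),
      fun i j => bif extendSigns p (e i) j then k j else -k j,
      fun i => ∏ j : {j // p j}, a j (e i j), fun i => hbloch _, fun x => ?_,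
      fun i j => hsign j _,
      (symmetricAboutAxes_extendSigns fun j hj => not_not.1 hj).comp_equiv e,
      Or.inl fun i i' hi => not_dualCongruent_extendSigns (fun j hj => hj) (e.injective.ne hi)⟩
    beta_reduce
    rw [prod_eq_sum_extendSigns (F := fun j b => F j b (x j)) (fun j hj => hp j hj (x j))
      fun j hj => congrFun (hnp j hj).symm (x j)]
    exact (e.sum_comp fun e' : {j // p j} → Bool => (∏ j : {j // p j}, a j (e' j)) *
      ∏ j, F j (extendSigns p e' j) (x j)).symm
  · push Not at hall
    have hk : ∀ j, ∃ m : ℤ, k j = m * Real.pi := fun j => not_not.1 (hall j)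
    -- `Ψ` is itself a Bloch solution. Since `s ≥ 1` is required it is listed twice, the second time
    -- with coefficient 0.
    refine ⟨1, le_refl 1, hd, fun _ x => ∏ j, F j true (x j), fun _ => k, Pi.single 0 1,
      fun _ => hbloch fun _ => true, fun x => ?_, fun _ j => hkI j, fun j => ?_,
      Or.inr ⟨rfl, fun _ => hk⟩⟩
    · simp [Pi.single_apply, hnp _ (hall _)]
    · obtain ⟨m, hm⟩ := hk j
      refine ⟨1, fun _ => ⟨Pi.single j m, fun i => ?_⟩⟩
      rcases eq_or_ne i j with rfl | hi
      · simp only [reflect, Function.update_self, Pi.single_eq_same, hm]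
        ring
      · simp [reflect, hi]
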